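/- Let $X$ be an infinite-dimensional real or complex Banach space and let $(a_n)_{n\ge 1}$ be a sequence of positive real numbers with $\sum_{n=1}^\infty a_n^{-2}=\infty$. Then there is a sequence $(x_n)_{n\ge 1}$ in $X$ with $\|x_n\|=a_n$ for every $n$ that has $0$ as a weak cluster point, i.e. every neighbourhood of $0$ in the weak topology of $X$ contains $x_n$ for infinitely many $n$. -/

import Mathlib

open Filter Topology

/-!
The blocks that make up the sequence `x` come from the Dvoretzky–Rogers lemma, in the following
form: in an infinite-dimensional space there are, for every `N`, unit vectors `e₀, …, e_{N-1}` such
that `∑ ‖f eᵢ‖² ≤ 9 ‖f‖²` for every continuous functional `f`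
(`exists_unit_vectors_sum_sq_le`).

To prove it, embed a Hilbert space `V` of dimension `2N` into `X` and choose, among all linear maps
`T : V → X` with the same range and `‖T‖ ≤ 1`, one of maximal determinant
(`exists_contraction_max_det`). On a subspace `K` of dimension more than `N` such a map cannot
satisfy `‖T v‖ ≤ ‖v‖ / 3`: composing it with `1 + P`, where `P` is the orthogonal projection onto
`K`, would multiply the norm by at most `4/3`, hence the admissible determinant by at least
`2 ^ (dim K) * (3/4) ^ (2N) > 1` (`exists_third_lt_norm_of_max_det`). So as long as fewer than `N`
vectors have been chosen, their orthogonal complement contains another unit vector with image of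
norm at least `1/3`. The images of the resulting orthonormal family, divided by their norms, are
the `eᵢ`, by Bessel's inequality.

Now cut `ℕ` into consecutive finite blocks such that `∑ (a n)⁻²` over the `k`-th block is at least
`k`, and on every block put `x n = a n • e n` for a family `e` as above. If finitely many
functionals `f` satisfied `max_f ‖f (x n)‖ ≥ r` for all `n` in the `k`-th block, summing
`‖f (e n)‖² = ‖f (x n)‖² / (a n)²` over `f` and `n` would give `r² k ≤ 9 ∑_f ‖f‖²`, which fails
for large `k`.
-/

/-! ### Linear maps of maximal determinant -/

lemma Submodule.det_one_add_starProjection {𝕜 V : Type*} [RCLike 𝕜] [NormedAddCommGroup V]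
    [InnerProductSpace 𝕜 V] [FiniteDimensional 𝕜 V] (K : Submodule 𝕜 V) :
    (1 + K.starProjection : V →L[𝕜] V).det = 2 ^ Module.finrank 𝕜 K := by
  let e := K.prodEquivOfIsCompl _ K.isCompl_orthogonal
  have key : (e.symm : V →ₗ[𝕜] K × Kᗮ) ∘ₗ ((1 + K.starProjection : V →L[𝕜] V) : V →ₗ[𝕜] V) ∘ₗ
      (e.symm.symm : (K × Kᗮ) →ₗ[𝕜] V) =
      ((2 : 𝕜) • (LinearMap.id : K →ₗ[𝕜] K)).prodMap (LinearMap.id : Kᗮ →ₗ[𝕜] Kᗮ) := by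
    ext1
    · ext1 x
      apply e.injective
      have h : K.starProjection (x : V) = x := K.starProjection_eq_self_iff.2 x.2
      simp [e, h, two_smul]
    · ext1 x
      apply e.injective
      have h : K.starProjection (x : V) = 0 := K.starProjection_apply_eq_zero_iff.2 x.2
      simp [e, h]
  rw [ContinuousLinearMap.det, ← LinearMap.det_conj _ e.symm, key, LinearMap.det_prodMap]
  simp

/-- Among the endomorphisms `A` of `V` for which `j ∘ A` is a contraction there is one whose
determinant has maximal absolute value; `A` maps the unit ball of `V` onto an ellipsoid of maximal
volume in the unit ball of the norm `‖j ·‖`. -/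
lemma exists_contraction_max_det {𝕜 V X : Type*} [RCLike 𝕜] [NormedAddCommGroup V]
    [InnerProductSpace 𝕜 V] [FiniteDimensional 𝕜 V] [NormedAddCommGroup X] [NormedSpace 𝕜 X]
    (j : V →L[𝕜] X) (hj : Function.Injective j) :
    ∃ A : V →L[𝕜] V, A.det ≠ 0 ∧ (∀ v, ‖j (A v)‖ ≤ ‖v‖) ∧
      ∀ B : V →L[𝕜] V, (∀ v, ‖j (B v)‖ ≤ ‖v‖) → ‖B.det‖ ≤ ‖A.det‖ := by
  obtain ⟨C, -, hC⟩ := (j : V →ₗ[𝕜] X).exists_antilipschitzWith (LinearMap.ker_eq_bot.2 hj)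
  let S : Set (V →L[𝕜] V) := {A | ∀ v, ‖j (A v)‖ ≤ ‖v‖}
  have hclosed : IsClosed S := by
    have : S = ⋂ v, {A : V →L[𝕜] V | ‖j (A v)‖ ≤ ‖v‖} := by ext; simp [S]
    rw [this]
    exact isClosed_iInter fun v => isClosed_le (by fun_prop) continuous_const
  have hbdd : Bornology.IsBounded S := by
    refine isBounded_iff_forall_norm_le.2 ⟨C, fun A hA => ?_⟩
    refine A.opNorm_le_bound C.2 fun v => ?_
    have h1 := hC.le_mul_dist (A v) 0
    simp only [ContinuousLinearMap.coe_coe, map_zero, dist_zero_right] at h1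
    exact h1.trans (mul_le_mul_of_nonneg_left (hA v) C.2)
  have : ProperSpace (V →L[𝕜] V) := FiniteDimensional.proper_rclike 𝕜 _
  have hcomp : IsCompact S := Metric.isCompact_of_isClosed_isBounded hclosed hbdd
  obtain ⟨A, hA, hmax⟩ := hcomp.exists_isMaxOn ⟨0, by simp [S]⟩
    (f := fun A : V →L[𝕜] V => ‖A.det‖) ContinuousLinearMap.continuous_det.norm.continuousOn
  refine ⟨A, ?_, hA, fun B hB => hmax hB⟩
  -- A small multiple of the identity is admissible, so the maximum is positive.
  have hpos : 0 < ‖j‖ + 1 := by positivity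
  let c : 𝕜 := (((‖j‖ + 1)⁻¹ : ℝ) : 𝕜)
  have hcn : ‖c‖ = (‖j‖ + 1)⁻¹ := by
    simp only [c, RCLike.norm_ofReal, abs_of_pos (inv_pos.2 hpos)]
  have hc : c ≠ 0 := norm_ne_zero_iff.1 (by rw [hcn]; positivity)
  have hcS : c • (1 : V →L[𝕜] V) ∈ S := by
    intro v
    have h1 : ‖j v‖ ≤ (‖j‖ + 1) * ‖v‖ :=
      (j.le_opNorm v).trans (by gcongr; linarith)
    simp only [smul_apply, one_apply_eq_self, map_smul, norm_smul,
      hcn]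
    rwa [inv_mul_le_iff₀ hpos]
  have h2 : ‖(c • (1 : V →L[𝕜] V)).det‖ ≤ ‖A.det‖ := hmax hcS
  have h3 : (c • (1 : V →L[𝕜] V)).det = c ^ Module.finrank 𝕜 V := by
    simp [ContinuousLinearMap.det]
  intro h0
  rw [h0, norm_zero, h3, norm_le_zero_iff] at h2
  exact pow_ne_zero _ hc h2

/-- A contraction of maximal determinant is bounded below by `1/3` somewhere on the unit sphere of
every subspace of more than half the dimension. -/
lemma exists_third_lt_norm_of_max_det {𝕜 V X : Type*} [RCLike 𝕜] [NormedAddCommGroup V]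
    [InnerProductSpace 𝕜 V] [FiniteDimensional 𝕜 V] [NormedAddCommGroup X] [NormedSpace 𝕜 X]
    {j : V →L[𝕜] X} {A : V →L[𝕜] V} (hdet : A.det ≠ 0) (hA : ∀ v, ‖j (A v)‖ ≤ ‖v‖)
    (hmax : ∀ B : V →L[𝕜] V, (∀ v, ‖j (B v)‖ ≤ ‖v‖) → ‖B.det‖ ≤ ‖A.det‖)
    {N : ℕ} (hV : Module.finrank 𝕜 V = 2 * N) {K : Submodule 𝕜 V}
    (hK : N < Module.finrank 𝕜 K) :
    ∃ v ∈ K, ‖v‖ = 1 ∧ 1 / 3 < ‖j (A v)‖ := by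
  by_contra! hcon
  have hsmall : ∀ v ∈ K, ‖j (A v)‖ ≤ 1 / 3 * ‖v‖ := by
    intro v hv
    rcases eq_or_ne v 0 with rfl | hv0
    · simp
    have h1 := hcon (((‖v‖⁻¹ : ℝ) : 𝕜) • v) (K.smul_mem _ hv) (by
      rw [norm_smul, RCLike.norm_ofReal, abs_of_nonneg (by positivity),
        inv_mul_cancel₀ (norm_ne_zero_iff.2 hv0)])
    rw [map_smul, map_smul, norm_smul, RCLike.norm_ofReal, abs_of_nonneg (by positivity),
      inv_mul_le_iff₀ (norm_pos_iff.2 hv0)] at h1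
    linarith
  let c : 𝕜 := ((3 / 4 : ℝ) : 𝕜)
  have hcn : ‖c‖ = 3 / 4 := by simp only [c, RCLike.norm_ofReal]; norm_num
  let B : V →L[𝕜] V := c • (A * (1 + K.starProjection))
  have hB : ∀ v, ‖j (B v)‖ ≤ ‖v‖ := by
    intro v
    have h1 : ‖j (A (v + K.starProjection v))‖ ≤ 4 / 3 * ‖v‖ := by
      have h2 := hsmall (K.starProjection v) (K.starProjection_apply_mem v)
      have h3 : ‖K.starProjection v‖ ≤ ‖v‖ := K.norm_starProjection_apply_le v
      have h4 := hA v
      rw [map_add, map_add]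
      refine (norm_add_le _ _).trans ?_
      linarith
    have h5 : j (B v) = c • j (A (v + K.starProjection v)) := by simp [B]
    rw [h5, norm_smul, hcn]
    linarith
  have hBdet : ‖B.det‖ = (3 / 4) ^ (2 * N) * (‖A.det‖ * 2 ^ Module.finrank 𝕜 K) := by
    have h1 : B.det = c ^ (2 * N) * (A.det * (1 + K.starProjection : V →L[𝕜] V).det) := by
      rw [← hV]
      simp only [B, ContinuousLinearMap.det, ContinuousLinearMap.toLinearMap_smul,
        LinearMap.det_smul]
      congr 1
      exact LinearMap.det_comp _ _
    rw [h1, K.det_one_add_starProjection, norm_mul, norm_pow, hcn, norm_mul, norm_pow]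
    simp
  have h1 := hmax B hB
  have hpos : 0 < ‖A.det‖ := norm_pos_iff.2 hdet
  have h2 : (1 : ℝ) < (3 / 4) ^ (2 * N) * 2 ^ Module.finrank 𝕜 K := by
    calc (1 : ℝ) ≤ (9 / 8) ^ N := one_le_pow₀ (by norm_num)
      _ = (3 / 4) ^ (2 * N) * 2 ^ N := by rw [pow_mul, ← mul_pow]; norm_num
      _ < (3 / 4) ^ (2 * N) * 2 ^ Module.finrank 𝕜 K := by
        gcongr
        norm_num
  rw [hBdet] at h1
  nlinarith

/-! ### The Dvoretzky–Rogers lemma -/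

/-- Every infinite-dimensional normed space contains arbitrarily many unit vectors whose weak
`ℓ²`-norm is at most `3`. The family is indexed by `ℕ`, but only its first `N` terms are
controlled by the inequality. -/
lemma exists_unit_vectors_sum_sq_le {𝕜 X : Type*} [RCLike 𝕜] [NormedAddCommGroup X]
    [NormedSpace 𝕜 X] (hX : ¬ FiniteDimensional 𝕜 X) (N : ℕ) :
    ∃ e : ℕ → X, (∀ n, ‖e n‖ = 1) ∧
      ∀ f : StrongDual 𝕜 X, ∑ n ∈ Finset.range N, ‖f (e n)‖ ^ 2 ≤ 9 * ‖f‖ ^ 2 := by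
  let V := EuclideanSpace 𝕜 (Fin (2 * N))
  have hV : Module.finrank 𝕜 V = 2 * N := by simp [V]
  have hrank : ((2 * N : ℕ) : Cardinal) ≤ Module.rank 𝕜 X :=
    Cardinal.natCast_lt_aleph0.le.trans
      (not_lt.1 fun h => hX (Module.rank_lt_aleph0_iff.1 h))
  obtain ⟨b, hb⟩ := exists_linearIndependent_of_le_rank hrank
  let j : V →L[𝕜] X :=
    (Fintype.linearCombination 𝕜 b ∘ₗ (WithLp.linearEquiv 2 𝕜 (Fin (2 * N) → 𝕜)).toLinearMap
      ).toContinuousLinearMap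
  have hj : Function.Injective j :=
    (linearIndependent_iff_injective_fintypeLinearCombination.1 hb).comp
      (WithLp.linearEquiv 2 𝕜 (Fin (2 * N) → 𝕜)).injective
  obtain ⟨A, hdet, hA, hmax⟩ := exists_contraction_max_det j hj
  have hfam : ∀ m ≤ N, ∃ v : Fin m → V, Orthonormal 𝕜 v ∧ ∀ i, 1 / 3 < ‖j (A (v i))‖ := by
    intro m
    induction m with
    | zero => exact fun _ => ⟨Fin.elim0, ⟨fun i => i.elim0, fun i => i.elim0⟩, fun i => i.elim0⟩
    | succ m ih =>
      intro hm
      obtain ⟨v, hv, hv3⟩ := ih (by omega)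
      have hK : N < Module.finrank 𝕜 (Submodule.span 𝕜 (Set.range v))ᗮ := by
        have h1 := (Submodule.span 𝕜 (Set.range v)).finrank_add_finrank_orthogonal
        have h2 : Module.finrank 𝕜 (Submodule.span 𝕜 (Set.range v)) ≤ m := by
          simpa [Set.finrank] using finrank_range_le_card (R := 𝕜) v
        omega
      obtain ⟨w, hwK, hw1, hw3⟩ := exists_third_lt_norm_of_max_det hdet hA hmax hV hK
      refine ⟨Matrix.vecCons w v, orthonormal_vecCons_iff.2 ⟨hw1, fun i => ?_, hv⟩, ?_⟩
      · exact (Submodule.mem_orthogonal' _ _).1 hwK _ (Submodule.subset_span ⟨i, rfl⟩)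
      · exact Fin.cases hw3 hv3
  obtain ⟨v, hv, hv3⟩ := hfam N le_rfl
  have : Nontrivial X := by
    by_contra h
    rw [not_nontrivial_iff_subsingleton] at h
    exact hX inferInstance
  obtain ⟨u, hu⟩ := NormedSpace.exists_lt_norm 𝕜 X 0
  -- The unit vector in the direction of `u` fills up the sequence beyond `N`.
  let y : ℕ → X := fun n => if h : n < N then j (A (v ⟨n, h⟩)) else u
  have hy : ∀ n, 0 < ‖y n‖ := by
    intro n
    by_cases h : n < N
    · simpa only [y, h, dite_true] using lt_trans (by norm_num : (0 : ℝ) < 1 / 3) (hv3 ⟨n, h⟩)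
    · simpa [y, h] using hu
  refine ⟨fun n => ((‖y n‖⁻¹ : ℝ) : 𝕜) • y n, fun n => ?_, fun f => ?_⟩
  · rw [norm_smul, RCLike.norm_ofReal, abs_of_pos (inv_pos.2 (hy n)), inv_mul_cancel₀ (hy n).ne']
  let g : StrongDual 𝕜 V := f ∘L j ∘L A
  have hg : ‖g‖ ≤ ‖f‖ := g.opNorm_le_bound (norm_nonneg _) fun w =>
    (f.le_opNorm _).trans (mul_le_mul_of_nonneg_left (hA w) (norm_nonneg _))
  have hbessel : ∑ i, ‖g (v i)‖ ^ 2 ≤ ‖f‖ ^ 2 := by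
    have h1 := hv.sum_inner_products_le ((InnerProductSpace.toDual 𝕜 V).symm g)
      (s := Finset.univ)
    simp only [norm_inner_symm (v _), InnerProductSpace.toDual_symm_apply,
      LinearIsometryEquiv.norm_map] at h1
    exact h1.trans (by gcongr)
  rw [Finset.sum_range]
  calc ∑ i : Fin N, ‖f (((‖y i‖⁻¹ : ℝ) : 𝕜) • y i)‖ ^ 2 ≤ ∑ i : Fin N, 9 * ‖g (v i)‖ ^ 2 := by
        refine Finset.sum_le_sum fun i _ => ?_
        have hyi : y i = j (A (v i)) := by simp [y]
        have h1 : ‖y i‖⁻¹ ≤ 3 := by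
          rw [hyi, inv_le_comm₀ (lt_trans (by norm_num : (0 : ℝ) < 1 / 3) (hv3 i)) (by norm_num)]
          linarith [hv3 i]
        have h2 : g (v i) = f (y i) := by rw [hyi]; rfl
        rw [h2, map_smul, norm_smul, RCLike.norm_ofReal, abs_of_pos (inv_pos.2 (hy i)), mul_pow]
        have h3 : ‖y i‖⁻¹ ^ 2 ≤ 3 ^ 2 := pow_le_pow_left₀ (inv_nonneg.2 (norm_nonneg _)) h1 2
        nlinarith [sq_nonneg ‖f (y i)‖]
    _ = 9 * ∑ i, ‖g (v i)‖ ^ 2 := by rw [Finset.mul_sum]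
    _ ≤ 9 * ‖f‖ ^ 2 := by gcongr

/-! ### Gluing the blocks -/

/-- A series with divergent partial sums can be cut into consecutive blocks such that the `k`-th
block has sum at least `k`. -/
lemma exists_strictMono_le_sum_Ico {s : ℕ → ℝ}
    (hs : Tendsto (fun N : ℕ => ∑ n ∈ Finset.range N, s n) atTop atTop) :
    ∃ φ : ℕ → ℕ, StrictMono φ ∧
      ∀ k : ℕ, (k : ℝ) ≤ ∑ n ∈ Finset.Ico (φ k) (φ (k + 1)), s n := by
  have hstep : ∀ m k : ℕ, ∃ m', m < m' ∧ (k : ℝ) ≤ ∑ n ∈ Finset.Ico m m', s n := by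
    intro m k
    obtain ⟨m', h1, h2⟩ := ((hs.eventually_ge_atTop (k + ∑ n ∈ Finset.range m, s n)).and
      (eventually_gt_atTop m)).exists
    refine ⟨m', h2, ?_⟩
    rw [Finset.sum_Ico_eq_sub _ h2.le]
    linarith
  choose g hg1 hg2 using hstep
  let φ : ℕ → ℕ := fun k => Nat.rec 0 (fun k m => g m k) k
  exact ⟨φ, strictMono_nat_of_lt_succ fun k => hg1 (φ k) k, fun k => hg2 (φ k) k⟩

/-- It suffices to test weak clustering at `0` on finitely many functionals at a time. -/
lemma mapClusterPt_zero_weakSpace {𝕜 X : Type*} [RCLike 𝕜] [NormedAddCommGroup X]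
    [NormedSpace 𝕜 X] {x : ℕ → X}
    (h : ∀ (t : Finset (StrongDual 𝕜 X)) (r : ℝ), 0 < r →
      ∃ᶠ n in atTop, ∀ f ∈ t, ‖f (x n)‖ < r) :
    MapClusterPt (0 : WeakSpace 𝕜 X) atTop (fun n => toWeakSpace 𝕜 X (x n)) := by
  rw [mapClusterPt_iff_frequently]
  intro U hU
  obtain ⟨t, r, hr, hsub⟩ :=
    ((topDualPairing 𝕜 X).flip.weakBilin_withSeminorms.mem_nhds_iff 0 U).1 hU
  refine (h t r hr).mono fun n hn => hsub ?_
  exact (Seminorm.mem_ball_zero _).2 (Seminorm.finset_sup_apply_lt hr hn)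

theorem mainTheorem6 {𝕜 : Type*} [RCLike 𝕜] {X : Type*} [NormedAddCommGroup X]
    [NormedSpace 𝕜 X] [CompleteSpace X] (hX : ¬ FiniteDimensional 𝕜 X)
    (a : ℕ → ℝ) (ha : ∀ n, 0 < a n)
    (hsum : Tendsto (fun N : ℕ => ∑ n ∈ Finset.range N, a n ^ (-2 : ℤ)) atTop atTop) :
    ∃ x : ℕ → X, (∀ n, ‖x n‖ = a n) ∧
      MapClusterPt (0 : WeakSpace 𝕜 X) atTop (fun n => toWeakSpace 𝕜 X (x n)) := by
  obtain ⟨φ, hφ, hblock⟩ := exists_strictMono_le_sum_Ico hsum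
  choose v hv1 hv2 using fun k : ℕ => exists_unit_vectors_sum_sq_le hX (φ (k + 1))
  have hex : ∀ n, ∃ k, n < φ (k + 1) := fun n =>
    ⟨n, n.lt_succ_self.trans_le (hφ.le_apply (x := n + 1))⟩
  -- On the block `[φ k, φ (k + 1))` the index found is `k`, so the family `v k` is used there.
  let e : ℕ → X := fun n => v (Nat.find (hex n)) n
  have he : ∀ k, ∀ n ∈ Finset.Ico (φ k) (φ (k + 1)), e n = v k n := by
    intro k n hn
    rw [Finset.mem_Ico] at hn
    have : Nat.find (hex n) = k := (Nat.find_eq_iff _).2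
      ⟨hn.2, fun i hi => not_lt.2 ((hφ.monotone hi).trans hn.1)⟩
    simp only [e, this]
  have hesum : ∀ (k : ℕ) (f : StrongDual 𝕜 X),
      ∑ n ∈ Finset.Ico (φ k) (φ (k + 1)), ‖f (e n)‖ ^ 2 ≤ 9 * ‖f‖ ^ 2 := by
    intro k f
    rw [Finset.sum_congr rfl fun n hn => by rw [he k n hn]]
    refine le_trans (Finset.sum_le_sum_of_subset_of_nonneg ?_ fun _ _ _ => by positivity) (hv2 k f)
    intro n hn
    exact Finset.mem_range.2 (Finset.mem_Ico.1 hn).2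
  refine ⟨fun n => (a n : 𝕜) • e n, fun n => ?_, mapClusterPt_zero_weakSpace fun t r hr => ?_⟩
  · rw [norm_smul, RCLike.norm_ofReal, abs_of_pos (ha n), hv1, mul_one]
  rw [frequently_atTop]
  intro m
  obtain ⟨k, hk1, hk2⟩ := ((tendsto_natCast_atTop_atTop.eventually_gt_atTop
    ((∑ f ∈ t, 9 * ‖f‖ ^ 2) / r ^ 2)).and (eventually_ge_atTop m)).exists
  by_contra! hcon
  have hlarge : ∀ n ∈ Finset.Ico (φ k) (φ (k + 1)),
      r ^ 2 * a n ^ (-2 : ℤ) ≤ ∑ f ∈ t, ‖f (e n)‖ ^ 2 := by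
    intro n hn
    obtain ⟨f, hf, hfr⟩ := hcon n (hk2.trans (hφ.le_apply.trans (Finset.mem_Ico.1 hn).1))
    refine le_trans ?_ (Finset.single_le_sum (f := fun f => ‖f (e n)‖ ^ 2)
      (fun _ _ => by positivity) hf)
    rw [map_smul, norm_smul, RCLike.norm_ofReal, abs_of_pos (ha n)] at hfr
    have h1 : r ^ 2 ≤ (a n * ‖f (e n)‖) ^ 2 := pow_le_pow_left₀ hr.le hfr 2
    have h2 : a n ^ (-2 : ℤ) = (a n ^ 2)⁻¹ := by
      rw [zpow_neg]; norm_cast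
    have := ha n
    rw [h2, ← div_eq_mul_inv, div_le_iff₀ (by positivity)]
    linarith [mul_pow (a n) ‖f (e n)‖ 2]
  have h1 : r ^ 2 * k ≤ ∑ f ∈ t, 9 * ‖f‖ ^ 2 :=
    calc r ^ 2 * k ≤ r ^ 2 * ∑ n ∈ Finset.Ico (φ k) (φ (k + 1)), a n ^ (-2 : ℤ) := by
          gcongr
          exact hblock k
      _ ≤ ∑ n ∈ Finset.Ico (φ k) (φ (k + 1)), ∑ f ∈ t, ‖f (e n)‖ ^ 2 := by
          rw [Finset.mul_sum]
          exact Finset.sum_le_sum hlarge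
      _ = ∑ f ∈ t, ∑ n ∈ Finset.Ico (φ k) (φ (k + 1)), ‖f (e n)‖ ^ 2 := Finset.sum_comm
      _ ≤ ∑ f ∈ t, 9 * ‖f‖ ^ 2 := Finset.sum_le_sum fun f _ => hesum k f
  rw [div_lt_iff₀ (by positivity)] at hk1
  linarith
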